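/- Consider the linear-quadratic problem with dynamics $x_{k+1}=Ax_k+Bu_k$, $A\in\mathbb{R}^{n\times n}$, $B\in\mathbb{R}^{n\times m}$, and stage cost $\begin{pmatrix}x\\u\end{pmatrix}^\top H\begin{pmatrix}x\\u\end{pmatrix}$, $H=\begin{pmatrix}Q&S^\top\\S&R\end{pmatrix}$ symmetric. A solution of the associated DARE is a symmetric matrix $P\in\mathbb{R}^{n\times n}$ such that $R+B^\top PB$ is invertible and $$P=Q+A^\top PA-(S^\top+A^\top PB)K_P,\qquad K_P:=(R+B^\top PB)^{-1}(S+B^\top PA).$$ It is called stabilizing (respectively antistabilizing) if all complex eigenvalues $\mu$ of $A-BK_P$ satisfy $|\mu|<1$ (respectively $|\mu|>1$). Assume quadratic strict $(x,u)$-pre-dissipativity, i.e., there is a symmetric $\Lambda\in\mathbb{R}^{n\times n}$ with $$H_\Lambda=\begin{pmatrix}Q+\Lambda-A^\top\Lambda A & S^\top-A^\top\Lambda B\\ S-B^\top\Lambda A & R-B^\top\Lambda B\end{pmatrix}\succ0,$$ and assume that an antistabilizing solution $P_\mathrm{a}$ of the DARE exists. Then: (i) if $P$ is a solution of the DARE that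 is not stabilizing, then $P\nsucc P_\mathrm{a}$; (ii) if $P_\mathrm{s}$ is a stabilizing solution of the DARE, then $P_\mathrm{s}\succ P_\mathrm{a}$, and every solution $P\neq P_\mathrm{s}$ of the DARE satisfies $P\nsucc P_\mathrm{a}$; that is, $P_\mathrm{s}$ is the only solution of the DARE strictly above $P_\mathrm{a}$; (iii) if $(A,B)$ is stabilizable (i.e., all eigenvalues of $A-BF$ have modulus less than $1$ for some $F\in\mathbb{R}^{m\times n}$), then a stabilizing solution of the DARE exists and is unique. Here $X\succ Y$ means that $X-Y$ is symmetric positive definite. -/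

import Mathlib

open scoped Matrix

noncomputable section

/-- The data of a linear-quadratic problem with `n` states and `m` controls: dynamics
`x⁺ = A x + B u` and stage cost `ℓ(x,u) = (x,u)ᵀ H (x,u)` with `H = [Q Sᵀ; S R]` symmetric. -/
structure LQProblem (n m : ℕ) where
  A : Matrix (Fin n) (Fin n) ℝ
  B : Matrix (Fin n) (Fin m) ℝ
  Q : Matrix (Fin n) (Fin n) ℝ
  S : Matrix (Fin m) (Fin n) ℝ
  R : Matrix (Fin m) (Fin m) ℝ
  Q_symm : Q.IsSymm
  R_symm : R.IsSymm

/-- All complex eigenvalues `μ` of the real square matrix `M` satisfy `|μ| < 1`. -/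
def EigenvaluesInside {n : ℕ} (M : Matrix (Fin n) (Fin n) ℝ) : Prop :=
  ∀ μ ∈ spectrum ℂ (M.map (algebraMap ℝ ℂ)), ‖μ‖ < 1

/-- All complex eigenvalues `μ` of the real square matrix `M` satisfy `|μ| > 1`. -/
def EigenvaluesOutside {n : ℕ} (M : Matrix (Fin n) (Fin n) ℝ) : Prop :=
  ∀ μ ∈ spectrum ℂ (M.map (algebraMap ℝ ℂ)), 1 < ‖μ‖

namespace LQProblem

variable {n m : ℕ}

/-- The stage cost matrix `H_Λ` rotated with the storage function `λ(x) = xᵀ Λ x`. -/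
def rotatedCost (L : LQProblem n m) (Λ : Matrix (Fin n) (Fin n) ℝ) :
    Matrix (Fin n ⊕ Fin m) (Fin n ⊕ Fin m) ℝ :=
  Matrix.fromBlocks
    (L.Q + Λ - L.Aᵀ * Λ * L.A) (L.Sᵀ - L.Aᵀ * Λ * L.B)
    (L.S - L.Bᵀ * Λ * L.A)     (L.R - L.Bᵀ * Λ * L.B)

/-- Quadratic strict `(x,u)`-pre-dissipativity: `H_Λ ≻ 0` for some symmetric `Λ`. -/
def StrictlyPreDissipative (L : LQProblem n m) : Prop :=
  ∃ Λ : Matrix (Fin n) (Fin n) ℝ, Λ.IsSymm ∧ (L.rotatedCost Λ).PosDef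

/-- `(A,B)` is stabilizable. -/
def Stabilizable (L : LQProblem n m) : Prop :=
  ∃ F : Matrix (Fin m) (Fin n) ℝ, EigenvaluesInside (L.A - L.B * F)

/-- The feedback matrix `K = (R + Bᵀ P B)⁻¹ (S + Bᵀ P A)` associated with `P`. -/
def gain (L : LQProblem n m) (P : Matrix (Fin n) (Fin n) ℝ) : Matrix (Fin m) (Fin n) ℝ :=
  (L.R + L.Bᵀ * P * L.B)⁻¹ * (L.S + L.Bᵀ * P * L.A)

/-- `P` is a (symmetric) solution of the discrete algebraic Riccati equation. The inverse in the
feedback matrix is required to exist. -/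
structure IsDARESolution (L : LQProblem n m) (P : Matrix (Fin n) (Fin n) ℝ) : Prop where
  symm : P.IsSymm
  isUnit : IsUnit (L.R + L.Bᵀ * P * L.B)
  eq : P = L.Q + L.Aᵀ * P * L.A - (L.Sᵀ + L.Aᵀ * P * L.B) * L.gain P

/-- `P` is a stabilizing solution of the DARE. -/
def IsStabilizing (L : LQProblem n m) (P : Matrix (Fin n) (Fin n) ℝ) : Prop :=
  L.IsDARESolution P ∧ EigenvaluesInside (L.A - L.B * L.gain P)

/-- `P` is an antistabilizing solution of the DARE. -/
def IsAntistabilizing (L : LQProblem n m) (P : Matrix (Fin n) (Fin n) ℝ) : Prop :=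
  L.IsDARESolution P ∧ EigenvaluesOutside (L.A - L.B * L.gain P)

end LQProblem

end

/-!
With `M_P = A - B K_P`, the defining equation of a solution `P` gives, for every `P₁` with
`R + Bᵀ P₁ B` invertible, `𝓡(P₁) - P = M_Pᵀ (P₁ - P) M_{P₁}`, where `𝓡` is the Riccati operator.

For solutions `P` and `P_a` this reads `M_{P_a}ᵀ (P - P_a) M_P = P - P_a`. If `P - P_a` is
invertible, then `M_P` is similar to the transposed inverse of the antistable matrix `M_{P_a}`, so
`P` is stabilizing. Between two stabilizing solutions it is a Stein equation with stable
coefficients, whose only solution is `0`.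

Strict dissipativity yields `R + Bᵀ P_a B ≻ 0`: the storage function drops out of the rotated cost
at steady states, and as `1` is not an eigenvalue of `M_{P_a}` there is a steady state for each
value of `u + K_{P_a} x`; with storage matrix `-P_a`, the rotated cost is the quadratic form of
`R + Bᵀ P_a B` in that variable.

For existence, look for `P = P_a + Y⁻¹`. The Riccati equation becomes the Stein equation
`M Y Mᵀ = Y + B (R + Bᵀ P_a B)⁻¹ Bᵀ` with `M = M_{P_a}`. It is solvable because `M⁻¹` is stable,
its solution is positive semidefinite, and stabilizability makes it positive definite. The
stabilizing solution obtained lies strictly above `P_a` by construction, and by uniqueness it is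
every stabilizing solution.
-/

open Filter Topology

section Powers

theorem tendsto_pow_zero_of_spectralRadius_lt_one {𝔸 : Type*} [NormedRing 𝔸] [NormedAlgebra ℂ 𝔸]
    [CompleteSpace 𝔸] {a : 𝔸} (ha : spectralRadius ℂ a < 1) :
    Tendsto (a ^ ·) atTop (𝓝 0) := by
  obtain ⟨r, har, hr⟩ := ENNReal.lt_iff_exists_nnreal_btwn.1 ha
  have gelfand :=
    (spectrum.pow_nnnorm_pow_one_div_tendsto_nhds_spectralRadius a).eventually_lt_const har
  refine squeeze_zero_norm' ?_
    (tendsto_pow_atTop_nhds_zero_of_lt_one r.coe_nonneg (by exact_mod_cast hr))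
  filter_upwards [gelfand, eventually_gt_atTop 0] with k hroot hk
  have hk : (0 : ℝ) < k := by exact_mod_cast hk
  rw [one_div, ENNReal.rpow_inv_lt_iff hk, ENNReal.rpow_natCast] at hroot
  exact_mod_cast hroot.le

theorem tendsto_pow_zero_of_spectrum_norm_lt_one {𝔸 : Type*} [NormedRing 𝔸] [NormedAlgebra ℂ 𝔸]
    [CompleteSpace 𝔸] {a : 𝔸} (ha : ∀ μ ∈ spectrum ℂ a, ‖μ‖ < 1) :
    Tendsto (a ^ ·) atTop (𝓝 0) := by
  cases subsingleton_or_nontrivial 𝔸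
  · exact tendsto_const_nhds.congr fun _ => Subsingleton.elim _ _
  · refine tendsto_pow_zero_of_spectralRadius_lt_one ?_
    exact_mod_cast spectrum.spectralRadius_lt_of_forall_lt a (r := 1) fun μ hμ =>
      by exact_mod_cast ha μ hμ

open scoped Matrix.Norms.L2Operator in
theorem EigenvaluesInside.tendsto_pow_zero {n : ℕ} {M : Matrix (Fin n) (Fin n) ℝ}
    (hM : EigenvaluesInside M) : Tendsto (M ^ ·) atTop (𝓝 0) := by
  have hre : Continuous fun N : Matrix (Fin n) (Fin n) ℂ => N.map Complex.re := by fun_prop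
  have hlim := (hre.tendsto 0).comp (tendsto_pow_zero_of_spectrum_norm_lt_one hM)
  rw [Matrix.map_zero _ Complex.zero_re] at hlim
  refine hlim.congr fun k => ?_
  have hpow : (M.map (algebraMap ℝ ℂ)) ^ k = (M ^ k).map (algebraMap ℝ ℂ) :=
    (map_pow (algebraMap ℝ ℂ).mapMatrix M k).symm
  rw [Function.comp_apply, hpow, Matrix.map_map]
  exact Matrix.map_id' _

end Powers

section Spectrum

theorem spectrum_eq_of_semiconjBy {R A : Type*} [CommSemiring R] [Ring A] [Algebra R A] {d : Aˣ}
    {a b : A} (h : SemiconjBy (d : A) a b) : spectrum R a = spectrum R b := by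
  rw [← spectrum.units_conjugate (a := a) (u := d), h.eq, Units.mul_inv_cancel_right]

theorem isUnit_map_iff_isUnit {ι R S : Type*} [Fintype ι] [DecidableEq ι] [CommRing R]
    [CommRing S] (f : R →+* S) [IsLocalHom f] {M : Matrix ι ι R} :
    IsUnit (M.map f) ↔ IsUnit M := by
  rw [Matrix.isUnit_iff_isUnit_det, Matrix.isUnit_iff_isUnit_det, ← RingHom.mapMatrix_apply,
    ← RingHom.map_det, isUnit_map_iff]

theorem spectrum_transpose {ι R : Type*} [Fintype ι] [DecidableEq ι] [CommRing R]
    (M : Matrix ι ι R) : spectrum R Mᵀ = spectrum R M := by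
  ext μ
  rw [spectrum.mem_iff, spectrum.mem_iff, ← Matrix.isUnit_transpose, Matrix.transpose_sub,
    Matrix.transpose_transpose, Matrix.algebraMap_eq_diagonal, Matrix.diagonal_transpose]

variable {n : ℕ} {M N : Matrix (Fin n) (Fin n) ℝ}

theorem EigenvaluesInside.transpose (hM : EigenvaluesInside M) : EigenvaluesInside Mᵀ := by
  rwa [EigenvaluesInside, Matrix.transpose_map, spectrum_transpose]

theorem EigenvaluesInside.of_semiconjBy {D : Matrix (Fin n) (Fin n) ℝ} (hD : IsUnit D)
    (h : SemiconjBy D N M) (hM : EigenvaluesInside M) : EigenvaluesInside N := by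
  let f := (algebraMap ℝ ℂ).mapMatrix (m := Fin n)
  obtain ⟨d, hd⟩ := hD.map f
  have hconj : SemiconjBy (d : Matrix (Fin n) (Fin n) ℂ) (f N) (f M) := hd ▸ h.map f
  intro μ hμ
  exact hM μ (spectrum_eq_of_semiconjBy (R := ℂ) hconj ▸ hμ)

theorem EigenvaluesOutside.isUnit_algebraMap_sub (hM : EigenvaluesOutside M) {r : ℝ}
    (hr : |r| ≤ 1) : IsUnit (algebraMap ℝ _ r - M) := by
  have hr_notMem : (r : ℂ) ∉ spectrum ℂ (M.map (algebraMap ℝ ℂ)) := fun hmem =>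
    (hM _ hmem).not_ge (by simpa using hr)
  rw [spectrum.notMem_iff] at hr_notMem
  rw [← isUnit_map_iff_isUnit (algebraMap ℝ ℂ)]
  convert hr_notMem using 1
  ext i j
  simp [Matrix.algebraMap_matrix_apply, apply_ite]

theorem EigenvaluesOutside.isUnit (hM : EigenvaluesOutside M) : IsUnit M := by
  simpa using hM.isUnit_algebraMap_sub (r := 0) (by simp)

theorem EigenvaluesOutside.isUnit_one_sub (hM : EigenvaluesOutside M) : IsUnit (1 - M) := by
  simpa using hM.isUnit_algebraMap_sub (r := 1) (by simp)

theorem EigenvaluesOutside.inv (hM : EigenvaluesOutside M) : EigenvaluesInside M⁻¹ := by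
  obtain ⟨a, rfl⟩ := hM.isUnit
  let b := Units.map ((algebraMap ℝ ℂ).mapMatrix (m := Fin n)).toMonoidHom a
  intro μ hμ
  have hμ' : μ ∈ spectrum ℂ (↑b⁻¹ : Matrix (Fin n) (Fin n) ℂ) := by
    rwa [← Matrix.coe_units_inv] at hμ
  have hinv : 1 < ‖μ‖⁻¹ := norm_inv μ ▸ hM _ (spectrum.inv₀_mem_iff.2 hμ')
  exact (one_lt_inv_iff₀.1 hinv).2

end Spectrum

section Stein

open scoped ComplexOrder

theorem eq_zero_of_mul_mul_eq {R : Type*} [MonoidWithZero R] [TopologicalSpace R]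
    [ContinuousMul R] [T2Space R] {a b x : R} (ha : Tendsto (a ^ ·) atTop (𝓝 0))
    (hb : Tendsto (b ^ ·) atTop (𝓝 0)) (h : a * x * b = x) : x = 0 := by
  have hpow (k : ℕ) : a ^ k * x * b ^ k = x := by
    induction k with
    | zero => simp
    | succ k ih =>
      calc a ^ (k + 1) * x * b ^ (k + 1) = a ^ k * (a * x * b) * b ^ k := by
            simp only [pow_succ a, pow_succ' b, mul_assoc]
        _ = x := by rw [h, ih]
  have hlim := (ha.mul_const x).mul hb
  simp only [hpow, zero_mul] at hlim
  exact tendsto_nhds_unique tendsto_const_nhds hlim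

theorem exists_sub_mul_mul_eq (𝕜 : Type*) {R : Type*} [Field 𝕜] [Ring R] [Algebra 𝕜 R]
    [FiniteDimensional 𝕜 R] [TopologicalSpace R] [ContinuousMul R] [T2Space R] {a b : R}
    (ha : Tendsto (a ^ ·) atTop (𝓝 0)) (hb : Tendsto (b ^ ·) atTop (𝓝 0)) (w : R) :
    ∃ y, y - a * y * b = w := by
  let T : R →ₗ[𝕜] R := LinearMap.id - LinearMap.mulRight 𝕜 b ∘ₗ LinearMap.mulLeft 𝕜 a
  have hT : Function.Injective T :=
    (injective_iff_map_eq_zero T).2 fun y hy =>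
      eq_zero_of_mul_mul_eq ha hb (sub_eq_zero.1 hy).symm
  exact LinearMap.surjective_of_injective hT w

theorem isClosed_setOf_posSemidef {ι 𝕜 : Type*} [Finite ι] [RCLike 𝕜] :
    IsClosed {A : Matrix ι ι 𝕜 | A.PosSemidef} := by
  cases nonempty_fintype ι
  simp only [Matrix.posSemidef_iff_dotProduct_mulVec, Set.ofPred_and, Set.ofPred_forall]
  refine .inter (isClosed_eq (by fun_prop) continuous_id) (isClosed_iInter fun x => ?_)
  exact isClosed_le continuous_const (by fun_prop)

variable {ι κ 𝕜 : Type*} [Fintype ι] [Fintype κ] [RCLike 𝕜] {A Y : Matrix ι ι 𝕜} {B : Matrix ι κ 𝕜}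
  {W : Matrix κ κ 𝕜}

theorem mulVec_eq_zero_of_stein (hW : W.PosDef) (hY : Y.PosSemidef)
    (h : A * Y * Aᴴ = Y + B * W * Bᴴ) {x : ι → 𝕜} (hx : Y *ᵥ (Aᴴ *ᵥ x) = 0) :
    Y *ᵥ x = 0 ∧ Bᴴ *ᵥ x = 0 := by
  have hsum : star x ⬝ᵥ (Y *ᵥ x) + star (Bᴴ *ᵥ x) ⬝ᵥ (W *ᵥ (Bᴴ *ᵥ x)) = 0 := by
    have hform := congrArg (fun Z => star x ⬝ᵥ (Z *ᵥ x)) h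
    simp only [Matrix.add_mulVec, ← Matrix.mulVec_mulVec, hx, Matrix.mulVec_zero,
      dotProduct_zero, dotProduct_add] at hform
    rw [hform, Matrix.star_mulVec, Matrix.conjTranspose_conjTranspose, ← Matrix.dotProduct_mulVec]
  obtain ⟨hYx, hWx⟩ := (add_eq_zero_iff_of_nonneg (hY.dotProduct_mulVec_nonneg x)
    (hW.posSemidef.dotProduct_mulVec_nonneg (Bᴴ *ᵥ x))).1 hsum
  refine ⟨(hY.dotProduct_mulVec_zero_iff x).1 hYx, ?_⟩
  by_contra hBx
  exact (hW.dotProduct_mulVec_pos hBx).ne' hWx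

variable [DecidableEq ι]

theorem tendsto_conjTranspose_pow_zero (hA : Tendsto (A ^ ·) atTop (𝓝 0)) :
    Tendsto (Aᴴ ^ ·) atTop (𝓝 0) := by
  simpa only [star_pow, star_zero, Matrix.star_eq_conjTranspose] using hA.star

theorem posSemidef_of_posSemidef_sub {X : Matrix ι ι 𝕜} (hA : Tendsto (A ^ ·) atTop (𝓝 0))
    (h : (X - A * X * Aᴴ).PosSemidef) : X.PosSemidef := by
  have hpow (k : ℕ) : (X - A ^ k * X * (A ^ k)ᴴ).PosSemidef := by
    induction k with
    | zero => simpa using Matrix.PosSemidef.zero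
    | succ k ih =>
      convert ih.add (h.mul_mul_conjTranspose_same (A ^ k)) using 1
      simp only [pow_succ, Matrix.conjTranspose_mul, Matrix.mul_sub, Matrix.sub_mul, mul_assoc]
      abel
  refine isClosed_setOf_posSemidef.mem_of_tendsto (s := {A : Matrix ι ι 𝕜 | A.PosSemidef})
    (b := atTop) ?_ (.of_forall hpow)
  simpa using tendsto_const_nhds.sub
    ((hA.mul_const X).mul (tendsto_conjTranspose_pow_zero hA))

theorem eq_zero_of_mulVec_pow_succ_mulVec {R : Type*} [Semiring R] [TopologicalSpace R]
    [IsTopologicalSemiring R] [T2Space R] {M N : Matrix ι ι R} {x : ι → R}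
    (hM : Tendsto (M ^ ·) atTop (𝓝 0)) (hN : Tendsto (N ^ ·) atTop (𝓝 0))
    (h : ∀ k, N *ᵥ (M ^ (k + 1) *ᵥ x) = M ^ k *ᵥ x) : x = 0 := by
  have hpow (k : ℕ) : (N ^ k * M ^ k) *ᵥ x = x := by
    induction k with
    | zero => simp
    | succ k ih => rw [pow_succ N, mul_assoc, ← Matrix.mulVec_mulVec, ← Matrix.mulVec_mulVec, h,
        Matrix.mulVec_mulVec, ih]
  have hcont : Continuous fun X : Matrix ι ι R => X *ᵥ x := by fun_prop
  have hlim := (hcont.tendsto (0 * 0)).comp (hN.mul hM)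
  simp only [Function.comp_def, hpow, zero_mul, Matrix.zero_mulVec] at hlim
  exact tendsto_nhds_unique tendsto_const_nhds hlim

variable {C : Matrix ι ι 𝕜}

theorem mul_mul_conjTranspose_eq_add_iff {Z : Matrix ι ι 𝕜} (hCA : C * A = 1) :
    A * Y * Aᴴ = Y + Z ↔ Y - C * Y * Cᴴ = C * Z * Cᴴ := by
  have hAC : A * C = 1 := mul_eq_one_comm.1 hCA
  have hCAH : Aᴴ * Cᴴ = 1 := by rw [← Matrix.conjTranspose_mul, hCA, Matrix.conjTranspose_one]
  have hACH : Cᴴ * Aᴴ = 1 := mul_eq_one_comm.1 hCAH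
  rw [sub_eq_iff_eq_add', ← Matrix.add_mul, ← Matrix.mul_add]
  constructor <;> intro h
  · rw [← h, ← mul_assoc, ← mul_assoc, hCA, one_mul, mul_assoc, hCAH, mul_one]
  · nth_rw 1 [h]
    rw [← mul_assoc, ← mul_assoc, hAC, one_mul, mul_assoc, hACH, mul_one]

theorem posSemidef_of_stein (hCA : C * A = 1) (hC : Tendsto (C ^ ·) atTop (𝓝 0))
    (hW : W.PosSemidef) (h : A * Y * Aᴴ = Y + B * W * Bᴴ) : Y.PosSemidef := by
  refine posSemidef_of_posSemidef_sub hC ?_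
  rw [(mul_mul_conjTranspose_eq_add_iff hCA).1 h]
  exact (hW.mul_mul_conjTranspose_same B).mul_mul_conjTranspose_same C

-- `ker Y` is invariant under `Cᴴ` and `Bᴴ Cᴴ` vanishes on it, so there the stable matrix
-- `(A - B F)ᴴ` is a left inverse of the stable matrix `Cᴴ`, which forces `ker Y = 0`.
theorem posDef_of_stein {F : Matrix κ ι 𝕜} (hCA : C * A = 1)
    (hC : Tendsto (C ^ ·) atTop (𝓝 0)) (hF : Tendsto ((A - B * F) ^ ·) atTop (𝓝 0))
    (hW : W.PosDef) (h : A * Y * Aᴴ = Y + B * W * Bᴴ) : Y.PosDef := by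
  have hY : Y.PosSemidef := posSemidef_of_stein hCA hC hW.posSemidef h
  rw [hY.posDef_iff_isUnit, ← Matrix.mulVec_injective_iff_isUnit, ← Matrix.coe_mulVecLin,
    injective_iff_map_eq_zero]
  intro x hx
  have hAC (k : ℕ) : Aᴴ *ᵥ (Cᴴ ^ (k + 1) *ᵥ x) = Cᴴ ^ k *ᵥ x := by
    rw [Matrix.mulVec_mulVec, pow_succ', ← mul_assoc, ← Matrix.conjTranspose_mul, hCA,
      Matrix.conjTranspose_one, one_mul]
  have hYC (k : ℕ) : Y *ᵥ (Cᴴ ^ k *ᵥ x) = 0 := by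
    induction k with
    | zero => simpa using hx
    | succ k ih => exact (mulVec_eq_zero_of_stein hW hY h (by rwa [hAC])).1
  have hBC (k : ℕ) : Bᴴ *ᵥ (Cᴴ ^ (k + 1) *ᵥ x) = 0 :=
    (mulVec_eq_zero_of_stein hW hY h (by rw [hAC, hYC])).2
  refine eq_zero_of_mulVec_pow_succ_mulVec (tendsto_conjTranspose_pow_zero hC)
    (tendsto_conjTranspose_pow_zero hF) fun k => ?_
  rw [Matrix.conjTranspose_sub, Matrix.conjTranspose_mul, Matrix.sub_mulVec, hAC,
    ← Matrix.mulVec_mulVec, hBC, Matrix.mulVec_zero, sub_zero]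

theorem exists_posDef_stein {F : Matrix κ ι 𝕜} (hCA : C * A = 1)
    (hC : Tendsto (C ^ ·) atTop (𝓝 0)) (hF : Tendsto ((A - B * F) ^ ·) atTop (𝓝 0))
    (hW : W.PosDef) : ∃ Y : Matrix ι ι 𝕜, Y.PosDef ∧ A * Y * Aᴴ = Y + B * W * Bᴴ := by
  obtain ⟨Y, hY⟩ := exists_sub_mul_mul_eq 𝕜 hC (tendsto_conjTranspose_pow_zero hC)
    (C * (B * W * Bᴴ) * Cᴴ)
  have hstein := (mul_mul_conjTranspose_eq_add_iff hCA).2 hY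
  exact ⟨Y, posDef_of_stein hCA hC hF hW hstein, hstein⟩

end Stein

namespace LQProblem

variable {n m : ℕ} {L : LQProblem n m} {P P₁ P₂ Pa : Matrix (Fin n) (Fin n) ℝ}

/-- The matrix `R + Bᵀ P B` that is inverted in the feedback matrix: the Hessian in `u` of
`ℓ(x,u) + (A x + B u)ᵀ P (A x + B u)`, up to the factor `2`. -/
def controlWeight (L : LQProblem n m) (P : Matrix (Fin n) (Fin n) ℝ) :
    Matrix (Fin m) (Fin m) ℝ :=
  L.R + L.Bᵀ * P * L.B

/-- The state matrix `A - B K_P` of the dynamics under the feedback `u = -K_P x`. -/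
noncomputable def closedLoop (L : LQProblem n m) (P : Matrix (Fin n) (Fin n) ℝ) :
    Matrix (Fin n) (Fin n) ℝ :=
  L.A - L.B * L.gain P

/-- The Riccati operator, whose fixed points are the solutions of the DARE. It is meaningful only
where `L.controlWeight P` is invertible. -/
noncomputable def riccati (L : LQProblem n m) (P : Matrix (Fin n) (Fin n) ℝ) :
    Matrix (Fin n) (Fin n) ℝ :=
  L.Q + L.Aᵀ * P * L.A - (L.Sᵀ + L.Aᵀ * P * L.B) * L.gain P

theorem controlWeight_add (P D : Matrix (Fin n) (Fin n) ℝ) :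
    L.controlWeight (P + D) = L.controlWeight P + L.Bᵀ * D * L.B := by
  rw [controlWeight, controlWeight, Matrix.mul_add, Matrix.add_mul, add_assoc]

theorem controlWeight_isSymm (hP : P.IsSymm) : (L.controlWeight P).IsSymm := by
  simp only [Matrix.IsSymm, controlWeight, Matrix.transpose_add, Matrix.transpose_mul,
    Matrix.transpose_transpose, hP.eq, L.R_symm.eq, Matrix.mul_assoc]

theorem controlWeight_mul_gain (hP : IsUnit (L.controlWeight P)) :
    L.controlWeight P * L.gain P = L.S + L.Bᵀ * P * L.A :=
  Matrix.mul_nonsing_inv_cancel_left _ _ ((Matrix.isUnit_iff_isUnit_det _).1 hP)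

theorem transpose_B_mul_mul_closedLoop (hP : IsUnit (L.controlWeight P)) :
    L.Bᵀ * P * L.closedLoop P = L.R * L.gain P - L.S := by
  have hgain := controlWeight_mul_gain hP
  simp only [controlWeight, closedLoop, Matrix.add_mul, Matrix.mul_sub, Matrix.mul_assoc] at hgain ⊢
  linear_combination (norm := abel) -hgain

theorem transpose_A_mul_mul_closedLoop :
    L.Aᵀ * P * L.closedLoop P = L.riccati P - L.Q + L.Sᵀ * L.gain P := by
  simp only [riccati, closedLoop, Matrix.add_mul, Matrix.mul_sub, Matrix.mul_assoc]
  abel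

theorem transpose_sub_mul_mul_closedLoop (hP : IsUnit (L.controlWeight P))
    (F : Matrix (Fin m) (Fin n) ℝ) :
    (L.A - L.B * F)ᵀ * P * L.closedLoop P =
      L.riccati P - L.Q + L.Sᵀ * L.gain P + Fᵀ * L.S - Fᵀ * L.R * L.gain P := by
  rw [Matrix.transpose_sub, Matrix.transpose_mul, Matrix.sub_mul, Matrix.sub_mul,
    transpose_A_mul_mul_closedLoop, Matrix.mul_assoc Fᵀ, Matrix.mul_assoc Fᵀ,
    transpose_B_mul_mul_closedLoop hP, Matrix.mul_sub, Matrix.mul_assoc Fᵀ]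
  abel

namespace IsDARESolution

theorem riccati_eq (h : L.IsDARESolution P) : L.riccati P = P := h.eq.symm

theorem riccati_sub (h : L.IsDARESolution P) (hP₁ : IsUnit (L.controlWeight P₁)) :
    L.riccati P₁ - P = (L.closedLoop P)ᵀ * (P₁ - P) * L.closedLoop P₁ := by
  have hleft := transpose_sub_mul_mul_closedLoop hP₁ (L.gain P)
  have hright := congrArg Matrix.transpose (transpose_sub_mul_mul_closedLoop h.isUnit (L.gain P₁))
  rw [h.riccati_eq] at hright
  rw [← closedLoop] at hleft hright
  simp only [Matrix.transpose_sub, Matrix.transpose_add, Matrix.transpose_mul, h.symm.eq,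
    L.Q_symm.eq, L.R_symm.eq, Matrix.transpose_transpose, ← Matrix.mul_assoc] at hright
  rw [Matrix.mul_sub, Matrix.sub_mul, hleft, hright]
  abel

theorem closedLoop_transpose_mul_sub_mul_closedLoop (h₁ : L.IsDARESolution P₁)
    (h₂ : L.IsDARESolution P₂) :
    (L.closedLoop P₂)ᵀ * (P₁ - P₂) * L.closedLoop P₁ = P₁ - P₂ := by
  rw [← h₂.riccati_sub h₁.isUnit, h₁.riccati_eq]

theorem isStabilizing_of_isUnit_sub (h : L.IsDARESolution P) (hPa : L.IsAntistabilizing Pa)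
    (hD : IsUnit (P - Pa)) : L.IsStabilizing P := by
  refine ⟨h, hPa.2.inv.transpose.of_semiconjBy hD ?_⟩
  have hMa : (L.closedLoop Pa)⁻¹ᵀ * (L.closedLoop Pa)ᵀ = 1 := by
    have hdet : IsUnit (L.closedLoop Pa).det :=
      (Matrix.isUnit_iff_isUnit_det _).1 hPa.2.isUnit
    rw [← Matrix.transpose_mul, Matrix.mul_nonsing_inv _ hdet, Matrix.transpose_one]
  calc (P - Pa) * L.closedLoop P
      = (L.closedLoop Pa)⁻¹ᵀ * ((L.closedLoop Pa)ᵀ * (P - Pa) * L.closedLoop P) := by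
        rw [← mul_assoc, ← mul_assoc, hMa, one_mul]
    _ = (L.closedLoop Pa)⁻¹ᵀ * (P - Pa) := by
        rw [h.closedLoop_transpose_mul_sub_mul_closedLoop hPa.1]

theorem rotatedCost_neg (h : L.IsDARESolution P) :
    L.rotatedCost (-P) = (Matrix.fromCols (L.gain P) 1)ᵀ * L.controlWeight P *
      Matrix.fromCols (L.gain P) 1 := by
  have hgain : L.S + L.Bᵀ * P * L.A = L.controlWeight P * L.gain P :=
    (controlWeight_mul_gain h.isUnit).symm
  have hgainT : L.Sᵀ + L.Aᵀ * P * L.B = (L.gain P)ᵀ * L.controlWeight P := by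
    simpa only [Matrix.transpose_add, Matrix.transpose_mul, Matrix.transpose_transpose, h.symm.eq,
      (controlWeight_isSymm h.symm).eq, Matrix.mul_assoc] using congrArg Matrix.transpose hgain
  have hQ : L.Q + -P + L.Aᵀ * P * L.A = (L.gain P)ᵀ * L.controlWeight P * L.gain P := by
    have heq := h.riccati_eq
    rw [riccati, hgainT] at heq
    linear_combination (norm := abel) heq
  rw [Matrix.transpose_fromCols, Matrix.transpose_one, Matrix.fromRows_mul,
    Matrix.fromRows_mul_fromCols]
  simp only [rotatedCost, Matrix.mul_neg, Matrix.neg_mul, sub_neg_eq_add, hQ, hgainT, hgain,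
    Matrix.one_mul, Matrix.mul_one]
  rw [← controlWeight]

end IsDARESolution

theorem IsStabilizing.unique (h₁ : L.IsStabilizing P₁) (h₂ : L.IsStabilizing P₂) : P₁ = P₂ :=
  sub_eq_zero.1 <| eq_zero_of_mul_mul_eq h₂.2.transpose.tendsto_pow_zero h₁.2.tendsto_pow_zero
    (h₁.1.closedLoop_transpose_mul_sub_mul_closedLoop h₂.1)

theorem transpose_mul_rotatedCost_mul_eq_of_steady {κ : Type*} {T : Matrix (Fin n) κ ℝ}
    {U : Matrix (Fin m) κ ℝ} (h : L.A * T + L.B * U = T) (Λ₁ Λ₂ : Matrix (Fin n) (Fin n) ℝ) :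
    (Matrix.fromRows T U)ᵀ * L.rotatedCost Λ₁ * Matrix.fromRows T U =
      (Matrix.fromRows T U)ᵀ * L.rotatedCost Λ₂ * Matrix.fromRows T U := by
  have hrot (Λ : Matrix (Fin n) (Fin n) ℝ) :
      (Matrix.fromRows T U)ᵀ * L.rotatedCost Λ * Matrix.fromRows T U =
        (Matrix.fromRows T U)ᵀ * L.rotatedCost 0 * Matrix.fromRows T U + Tᵀ * Λ * T
          - (L.A * T + L.B * U)ᵀ * Λ * (L.A * T + L.B * U) := by
    simp only [rotatedCost, Matrix.mul_assoc, Matrix.fromBlocks_mul_fromRows,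
      Matrix.transpose_fromRows, Matrix.fromCols_mul_fromRows, Matrix.transpose_add,
      Matrix.transpose_mul, Matrix.mul_add, Matrix.add_mul, Matrix.mul_sub, Matrix.sub_mul,
      Matrix.zero_mul, Matrix.mul_zero]
    abel
  rw [hrot Λ₁, hrot Λ₂, h, add_sub_cancel_right, add_sub_cancel_right]

theorem IsDARESolution.controlWeight_posDef (h : L.IsDARESolution P)
    (hM : IsUnit (1 - L.closedLoop P)) (hdiss : L.StrictlyPreDissipative) :
    (L.controlWeight P).PosDef := by
  obtain ⟨Λ, -, hΛ⟩ := hdiss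
  have hM := (Matrix.isUnit_iff_isUnit_det _).1 hM
  let T := (1 - L.closedLoop P)⁻¹ * L.B
  let U := 1 - L.gain P * T
  have hsteady : L.A * T + L.B * U = T := by
    have hT : (1 - L.closedLoop P) * T = L.B := Matrix.mul_nonsing_inv_cancel_left _ _ hM
    rw [← sub_eq_zero, ← sub_eq_zero.2 hT.symm]
    simp only [U, closedLoop, Matrix.sub_mul, Matrix.mul_sub, Matrix.one_mul, Matrix.mul_one,
      Matrix.mul_assoc]
    abel
  let E : Matrix (Fin m) (Fin n ⊕ Fin m) ℝ := Matrix.fromCols (L.gain P) 1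
  have hKU : E * Matrix.fromRows T U = 1 := by
    rw [Matrix.fromCols_mul_fromRows, Matrix.one_mul, add_sub_cancel]
  have hinj : Function.Injective (Matrix.fromRows T U).mulVec :=
    Function.LeftInverse.injective (g := E.mulVec) fun x => by
      rw [Matrix.mulVec_mulVec, hKU, Matrix.one_mulVec]
  have hcongr : (Matrix.fromRows T U)ᵀ * L.rotatedCost Λ * Matrix.fromRows T U =
      L.controlWeight P := by
    calc (Matrix.fromRows T U)ᵀ * L.rotatedCost Λ * Matrix.fromRows T U
        = (Matrix.fromRows T U)ᵀ * L.rotatedCost (-P) * Matrix.fromRows T U :=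
          transpose_mul_rotatedCost_mul_eq_of_steady hsteady Λ (-P)
      _ = (E * Matrix.fromRows T U)ᵀ * L.controlWeight P * (E * Matrix.fromRows T U) := by
          simp only [E, h.rotatedCost_neg, Matrix.transpose_mul, Matrix.mul_assoc]
      _ = L.controlWeight P := by
          rw [hKU, Matrix.transpose_one, Matrix.one_mul, Matrix.mul_one]
  rw [← hcongr]
  exact hΛ.conjTranspose_mul_mul_same hinj

theorem closedLoop_eq_mul_closedLoop_add {D : Matrix (Fin n) (Fin n) ℝ}
    (hP : IsUnit (L.controlWeight P)) (hD : IsUnit (L.controlWeight (P + D))) :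
    L.closedLoop P =
      (1 + L.B * (L.controlWeight P)⁻¹ * L.Bᵀ * D) * L.closedLoop (P + D) := by
  have hV := (Matrix.isUnit_iff_isUnit_det _).1 hP
  have hgain : L.controlWeight P * (L.gain (P + D) - L.gain P) =
      L.Bᵀ * D * L.closedLoop (P + D) := by
    have h₁ := controlWeight_mul_gain hD
    have h₀ := controlWeight_mul_gain hP
    rw [controlWeight_add] at h₁
    simp only [closedLoop, Matrix.add_mul, Matrix.mul_add, Matrix.mul_sub,
      Matrix.mul_assoc] at h₀ h₁ ⊢
    linear_combination (norm := abel) h₁ - h₀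
  have hgain' : L.gain (P + D) - L.gain P =
      (L.controlWeight P)⁻¹ * (L.Bᵀ * D * L.closedLoop (P + D)) := by
    rw [← hgain]
    exact (Matrix.nonsing_inv_mul_cancel_left _ _ hV).symm
  rw [Matrix.add_mul, Matrix.one_mul]
  simp only [Matrix.mul_assoc] at hgain' ⊢
  rw [← hgain', closedLoop, closedLoop, Matrix.mul_sub]
  abel

theorem isUnit_controlWeight_add {D : Matrix (Fin n) (Fin n) ℝ} (hP : IsUnit (L.controlWeight P))
    (hD : IsUnit (1 + L.B * (L.controlWeight P)⁻¹ * L.Bᵀ * D)) :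
    IsUnit (L.controlWeight (P + D)) := by
  have hV := (Matrix.isUnit_iff_isUnit_det _).1 hP
  have hfactor : L.controlWeight (P + D) =
      L.controlWeight P * (1 + ((L.controlWeight P)⁻¹ * L.Bᵀ * D) * L.B) := by
    rw [controlWeight_add, Matrix.mul_add, Matrix.mul_one]
    simp only [Matrix.mul_assoc]
    rw [Matrix.mul_nonsing_inv_cancel_left _ _ hV]
  rw [hfactor]
  refine hP.mul ?_
  rw [Matrix.isUnit_iff_isUnit_det, Matrix.det_one_add_mul_comm, ← Matrix.isUnit_iff_isUnit_det]
  simpa only [Matrix.mul_assoc] using hD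

theorem IsDARESolution.add_inv (h : L.IsDARESolution P) {Y : Matrix (Fin n) (Fin n) ℝ}
    (hM : IsUnit (L.closedLoop P)) (hYs : Y.IsSymm) (hYu : IsUnit Y)
    (hY : L.closedLoop P * Y * (L.closedLoop P)ᵀ =
      Y + L.B * (L.controlWeight P)⁻¹ * L.Bᵀ) : L.IsDARESolution (P + Y⁻¹) := by
  have hYdet := (Matrix.isUnit_iff_isUnit_det _).1 hYu
  set M := L.closedLoop P with hMdef
  have hfactor : 1 + L.B * (L.controlWeight P)⁻¹ * L.Bᵀ * Y⁻¹ = M * Y * Mᵀ * Y⁻¹ := by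
    rw [hY, Matrix.add_mul, Matrix.mul_nonsing_inv _ hYdet]
  have hweight : IsUnit (L.controlWeight (P + Y⁻¹)) := by
    refine isUnit_controlWeight_add h.isUnit ?_
    rw [hfactor]
    exact ((hM.mul hYu).mul (M.isUnit_transpose.2 hM)).mul (Matrix.isUnit_nonsing_inv_iff.2 hYu)
  have hclosed : Y * (Mᵀ * Y⁻¹ * L.closedLoop (P + Y⁻¹)) = 1 := by
    have hcl := closedLoop_eq_mul_closedLoop_add h.isUnit hweight
    rw [hfactor, ← hMdef] at hcl
    refine hM.mul_left_cancel ?_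
    rw [mul_one]
    simpa only [mul_assoc] using hcl.symm
  have hric := h.riccati_sub hweight
  rw [add_sub_cancel_left, ← hMdef, ← Matrix.inv_eq_right_inv hclosed, sub_eq_iff_eq_add'] at hric
  refine ⟨h.symm.add ?_, hweight, hric.symm⟩
  rw [Matrix.IsSymm, Matrix.transpose_nonsing_inv, hYs.eq]

theorem IsAntistabilizing.exists_isStabilizing_posDef_sub (hPa : L.IsAntistabilizing Pa)
    (hV : (L.controlWeight Pa).PosDef) (hstab : L.Stabilizable) :
    ∃ P, L.IsStabilizing P ∧ (P - Pa).PosDef := by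
  obtain ⟨F, hF⟩ := hstab
  have hu := (Matrix.isUnit_iff_isUnit_det _).1 hPa.2.isUnit
  have hF' : EigenvaluesInside (L.closedLoop Pa - L.B * (F - L.gain Pa)) := by
    rwa [closedLoop, Matrix.mul_sub, sub_sub_sub_cancel_right]
  obtain ⟨Y, hYpos, hY⟩ := exists_posDef_stein (Matrix.nonsing_inv_mul _ hu)
    hPa.2.inv.tendsto_pow_zero hF'.tendsto_pow_zero hV.inv
  simp only [Matrix.conjTranspose_eq_transpose_of_trivial] at hY
  have hsub : Pa + Y⁻¹ - Pa = Y⁻¹ := add_sub_cancel_left Pa Y⁻¹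
  have hsol : L.IsDARESolution (Pa + Y⁻¹) :=
    hPa.1.add_inv hPa.2.isUnit hYpos.isHermitian hYpos.isUnit hY
  exact ⟨Pa + Y⁻¹, hsol.isStabilizing_of_isUnit_sub hPa (by rw [hsub]; exact hYpos.inv.isUnit),
    by rw [hsub]; exact hYpos.inv⟩

end LQProblem

theorem mainTheorem9 {n m : ℕ} (L : LQProblem n m) (hdiss : L.StrictlyPreDissipative)
    (Pa : Matrix (Fin n) (Fin n) ℝ) (hPa : L.IsAntistabilizing Pa) :
    -- no solution that is not stabilizing is strictly above `Pa`
    (∀ P : Matrix (Fin n) (Fin n) ℝ,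
      L.IsDARESolution P → ¬ L.IsStabilizing P → ¬ (P - Pa).PosDef) ∧
    -- the stabilizing solution is strictly above `Pa`, and no other solution is
    (∀ Ps : Matrix (Fin n) (Fin n) ℝ, L.IsStabilizing Ps →
      (Ps - Pa).PosDef ∧
      ∀ P : Matrix (Fin n) (Fin n) ℝ, L.IsDARESolution P → P ≠ Ps → ¬ (P - Pa).PosDef) ∧
    -- the stabilizing solution exists and is unique when `(A,B)` is stabilizable
    (L.Stabilizable → ∃! Ps : Matrix (Fin n) (Fin n) ℝ, L.IsStabilizing Ps) := by
  have hV := hPa.1.controlWeight_posDef hPa.2.isUnit_one_sub hdiss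
  have stabilizing_of_above {P : Matrix (Fin n) (Fin n) ℝ} (hP : L.IsDARESolution P)
      (hpos : (P - Pa).PosDef) : L.IsStabilizing P :=
    hP.isStabilizing_of_isUnit_sub hPa hpos.isUnit
  refine ⟨fun P hP hns hpos => hns (stabilizing_of_above hP hpos), fun Ps hPs => ⟨?_, ?_⟩,
    fun hstab => ?_⟩
  · obtain ⟨P, hP, hpos⟩ := hPa.exists_isStabilizing_posDef_sub hV ⟨L.gain Ps, hPs.2⟩
    rwa [hPs.unique hP]
  · exact fun P hP hne hpos => hne ((stabilizing_of_above hP hpos).unique hPs)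
  · obtain ⟨Ps, hPs, -⟩ := hPa.exists_isStabilizing_posDef_sub hV hstab
    exact ⟨Ps, hPs, fun P hP => hP.unique hPs⟩
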